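/- All groups are countable and discrete, and equalities of sets are understood up to null sets. Let $\Lambda$ and $\Gamma$ be groups. A $(\Lambda\rightarrowtail\Gamma)$-coupling is a standard measure space $(\Sigma,\mu)$, with $\mu$ nonzero and $\sigma$-finite (of finite or infinite total mass), with a measurable measure-preserving action of $\Lambda\times\Gamma$, for which there are Borel fundamental domains $Y$ for $\Lambda$ and $X$ for $\Gamma$, that is, $$\Sigma=\bigsqcup_{\gamma\in\Gamma}\gamma X=\bigsqcup_{\lambda\in\Lambda}\lambda Y,$$ such that $\mu(X)<\infty$ and $X\subset Y$. Its index is $[\Gamma:\Lambda]_\Sigma=\mu(Y)/\mu(X)\in[1,\infty]$, which does not depend on the choice of the fundamental domains. One says that $\Lambda$ strictly measurably imbeds into $\Gamma$, written $\Lambda\overset{\mathrm{SMI}}{\rightarrowtail}\Gamma$, if a $(\Lambda\rightarrowtail\Gamma)$-coupling exists. **Theorem A.** If $\Lambda_1\overset{\mathrm{SMI}}{\rightarrowtail}\Gamma_1$ and $\Lambda_2\overset{\mathrm{SMI}}{\rightarrowtail}\Gamma_2$, then $\Lambda_1*\Lambda_2\overset{\mathrm{SMI}}{\rightarrowtail}\Gamma_1*\Gamma_2$.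 Moreover, let $(\Lambda_i\rightarrowtail\Gamma_i)$-couplings $\Sigma_i$ with indices $[\Gamma_i:\Lambda_i]_{\Sigma_i}=c_i$ be given for $i=1,2$. If $c_1=c_2=1$, then there is a $(\Lambda_1*\Lambda_2\rightarrowtail\Gamma_1*\Gamma_2)$-coupling $\Sigma$ with $[\Gamma_1*\Gamma_2:\Lambda_1*\Lambda_2]_\Sigma=1$. Otherwise, if $\Gamma_1$ and $\Gamma_2$ are nontrivial, then there is a $(\Lambda_1*\Lambda_2\rightarrowtail\Gamma_1*\Gamma_2)$-coupling $\Sigma$ with $[\Gamma_1*\Gamma_2:\Lambda_1*\Lambda_2]_\Sigma=\infty$. -/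

import Mathlib

open MeasureTheory
open scoped ENNReal

universe u v w

/-- A strict measurable imbedding coupling of `Λ` into `Γ`: a nonzero `σ`-finite standard measure
space with commuting measurable measure preserving actions of `Λ` and `Γ` (that is, an action of
`Λ × Γ`), which admit Borel fundamental domains `Y` for `Λ` and `X` for `Γ` such that `X` has finite
measure and `X ⊆ Y`. In `IsFundamentalDomain`, translates are disjoint and cover
the space up to null sets. -/
structure SMICoupling (Λ : Type u) (Γ : Type v) [Group Λ] [Group Γ] where
  /-- the underlying space -/
  carrier : Type w
  [measurableSpace : MeasurableSpace carrier]
  [standardBorelSpace : StandardBorelSpace carrier]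
  [leftAction : MulAction Λ carrier]
  [rightAction : MulAction Γ carrier]
  /-- the measure -/
  μ : Measure carrier
  [sigmaFinite : SigmaFinite μ]
  ne_zero : μ ≠ 0
  smul_comm : ∀ (l : Λ) (g : Γ) (x : carrier), l • g • x = g • l • x
  measurePreserving_left : ∀ l : Λ, MeasurePreserving (fun x : carrier => l • x) μ μ
  measurePreserving_right : ∀ g : Γ, MeasurePreserving (fun x : carrier => g • x) μ μ
  exists_domains : ∃ Y X : Set carrier, MeasurableSet Y ∧ MeasurableSet X ∧
    IsFundamentalDomain Λ Y μ ∧ IsFundamentalDomain Γ X μ ∧ μ X < ∞ ∧ X ⊆ Y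

namespace SMICoupling

attribute [instance] measurableSpace standardBorelSpace leftAction rightAction sigmaFinite

variable {Λ : Type u} {Γ : Type v} [Group Λ] [Group Γ]

/-- The index `[Γ : Λ]_S = μ(Y) / μ(X)` of a coupling, an element of `[1, ∞]`. -/
noncomputable def index (S : SMICoupling.{u, v, w} Λ Γ) : ℝ≥0∞ :=
  S.μ S.exists_domains.choose / S.μ S.exists_domains.choose_spec.choose

/-- The index does not depend on the choice of the fundamental domains. -/
theorem index_eq [Countable Λ] [Countable Γ] (S : SMICoupling.{u, v, w} Λ Γ) {Y X : Set S.carrier}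
    (hY : IsFundamentalDomain Λ Y S.μ) (hX : IsFundamentalDomain Γ X S.μ) :
    S.index = S.μ Y / S.μ X := by
  obtain ⟨_, _, hY', hX', _, _⟩ := S.exists_domains.choose_spec.choose_spec
  have : MeasurableConstSMul Λ S.carrier := ⟨fun l => (S.measurePreserving_left l).measurable⟩
  have : MeasurableConstSMul Γ S.carrier := ⟨fun g => (S.measurePreserving_right g).measurable⟩
  have : SMulInvariantMeasure Λ S.carrier S.μ :=
    ⟨fun l _ hs => (S.measurePreserving_left l).measure_preimage hs.nullMeasurableSet⟩
  have : SMulInvariantMeasure Γ S.carrier S.μ :=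
    ⟨fun g _ hs => (S.measurePreserving_right g).measure_preimage hs.nullMeasurableSet⟩
  rw [index, hY'.measure_eq hY, hX'.measure_eq hX]

end SMICoupling

/-- `Λ` strictly measurably imbeds into `Γ`. -/
def SMI (Λ : Type u) (Γ : Type v) [Group Λ] [Group Γ] : Prop :=
  Nonempty (SMICoupling.{u, v, w} Λ Γ)

/-!
A coupling of `Λ` and `Γ` in which the domain `X` of `Γ` lies in a domain of `Λ` is the same thing as
a measure preserving action of `Λ` on `X` together with a measurable cocycle `c : Λ × X → Γ` such
that `c l x = 1` only for `l = 1`. The action sends `x` to the point of `X` in the `Γ`-orbit of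
`l • x`, the cocycle is the element of `Γ` that is needed, and the condition on `c` says that `X` meets
each `Λ`-orbit at most once (`SMICoupling.exists_injectiveCocycle`). Conversely, `Λ` acts on `X × Γ`
by `l • (x, γ) = (l • x, c l x * γ)`, and enumerating `Γ` with `1` first gives a domain for `Λ` that
contains `X × {1}`: in each orbit, take the point whose second coordinate comes first
(`InjectiveCocycle.toCoupling`). Almost every map `c · x : Λ → Γ` is injective, and the index is one
if and only if almost all of them are bijective.

In this language free products are immediate. By the universal property, two cocycles `c₁`, `c₂` over
`X₁`, `X₂` extend to a unique cocycle `c` of `Λ₁ * Λ₂` over `X₁ × X₂`, where each factor moves its own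
coordinate (`InjectiveCocycle.freeCocycle`). The value of `c` at a reduced word is a product of
values of `c₁` and `c₂` at its letters, hence is represented by a reduced word of the same length.
So `c` is again injective. If `c₁` and `c₂` are surjective, words can be built letter by letter, and
`c` is surjective as well (`InjectiveCocycle.freeCocycle_surjective`).

Suppose on the other hand that some `g` in `Γ₁`, say, is missed by `c₁ · x` for all `x` in a set of
positive measure, and let `h ≠ 1` be in `Γ₂`. For `x` in the corresponding subset `B` of `X₁ × X₂`, no
value `c w x` is represented by a reduced word that ends in `g`, in particular none is a positive
power of `h * g` (`InjectiveCocycle.freeCocycle_ne_pow`). Then the sets `B × {(h * g) ^ n}` together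
meet each orbit of `Λ₁ * Λ₂` at most once, so that a domain for `Λ₁ * Λ₂` has infinite measure
(`InjectiveCocycle.index_toCoupling_eq_top`).
-/

universe u₁ u₂ v₁ v₂

/-! ### Reduced words in a free product of two groups -/

namespace Monoid.Coprod

section Words

/-- The word `b a b a ⋯ b a`, with `k` repetitions. -/
def alternating {α : Type*} (b a : α) : ℕ → List α
  | 0 => []
  | k + 1 => b :: a :: alternating b a k

theorem getLast?_alternating {α : Type*} (b a : α) (k : ℕ) :
    (alternating b a (k + 1)).getLast? = some a := by
  induction k with
  | zero => rfl
  | succ k ih => rw [alternating, List.getLast?_cons_cons, List.getLast?_cons, ih]; rfl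

variable {M : Type u} {N : Type v} [Group M] [Group N]

/-- The element of the free product represented by a letter of one of the two factors. -/
def letter : M ⊕ N → Monoid.Coprod M N :=
  Sum.elim inl inr

/-- The element of the free product represented by a word. -/
def eval (l : List (M ⊕ N)) : Monoid.Coprod M N :=
  (l.map letter).prod

@[simp] theorem eval_nil : eval ([] : List (M ⊕ N)) = 1 := rfl

@[simp] theorem eval_cons (a : M ⊕ N) (l : List (M ⊕ N)) : eval (a :: l) = letter a * eval l := by
  simp [eval]

/-- A letter is nontrivial if it is not the identity of its factor. -/
def IsNontrivialLetter (a : M ⊕ N) : Prop :=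
  a ≠ .inl 1 ∧ a ≠ .inr 1

/-- A word is reduced if its letters are nontrivial and alternate between the two factors. -/
def IsReduced (l : List (M ⊕ N)) : Prop :=
  (∀ a ∈ l, IsNontrivialLetter a) ∧ l.IsChain fun a b => a.isLeft ≠ b.isLeft

theorem isReduced_nil : IsReduced ([] : List (M ⊕ N)) :=
  ⟨by simp, .nil⟩

theorem IsReduced.tail {a : M ⊕ N} {l : List (M ⊕ N)} (h : IsReduced (a :: l)) : IsReduced l :=
  ⟨fun b hb => h.1 b (List.mem_cons_of_mem _ hb), h.2.tail⟩

theorem isReduced_cons {a : M ⊕ N} {l : List (M ⊕ N)} :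
    IsReduced (a :: l) ↔
      IsNontrivialLetter a ∧ (∀ b ∈ l.head?, a.isLeft ≠ b.isLeft) ∧ IsReduced l := by
  simp only [IsReduced, List.mem_cons, forall_eq_or_imp, List.isChain_cons]
  tauto

/-- Every element of a free product is represented by a reduced word. -/
theorem exists_isReduced_eval_eq (x : Monoid.Coprod M N) : ∃ l, IsReduced l ∧ eval l = x := by
  induction x using induction_on' with
  | one => exact ⟨[], isReduced_nil, rfl⟩
  | inl_mul m x ih =>
    obtain ⟨l, hl, rfl⟩ := ih
    by_cases hm : m = 1
    · exact ⟨l, hl, by simp [hm]⟩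
    rcases l with _ | ⟨m' | n', l⟩
    · exact ⟨[.inl m], by simp [isReduced_cons, isReduced_nil, IsNontrivialLetter, hm],
        by simp [letter]⟩
    · by_cases hmm : m * m' = 1
      · exact ⟨l, hl.tail, by simp [letter, ← mul_assoc, ← map_mul, hmm]⟩
      · rw [isReduced_cons] at hl
        exact ⟨.inl (m * m') :: l, isReduced_cons.2 ⟨by simp [IsNontrivialLetter, hmm], hl.2⟩,
          by simp [letter, mul_assoc]⟩
    · exact ⟨.inl m :: .inr n' :: l,
        isReduced_cons.2 ⟨by simp [IsNontrivialLetter, hm], by simp, hl⟩, by simp [letter]⟩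
  | inr_mul n x ih =>
    obtain ⟨l, hl, rfl⟩ := ih
    by_cases hn : n = 1
    · exact ⟨l, hl, by simp [hn]⟩
    rcases l with _ | ⟨m' | n', l⟩
    · exact ⟨[.inr n], by simp [isReduced_cons, isReduced_nil, IsNontrivialLetter, hn],
        by simp [letter]⟩
    · exact ⟨.inr n :: .inl m' :: l,
        isReduced_cons.2 ⟨by simp [IsNontrivialLetter, hn], by simp, hl⟩, by simp [letter]⟩
    · by_cases hnn : n * n' = 1
      · exact ⟨l, hl.tail, by simp [letter, ← mul_assoc, ← map_mul, hnn]⟩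
      · rw [isReduced_cons] at hl
        exact ⟨.inr (n * n') :: l, isReduced_cons.2 ⟨by simp [IsNontrivialLetter, hnn], hl.2⟩,
          by simp [letter, mul_assoc]⟩

/-- The two factors as a family indexed by `Bool`, the left one at `true`. They are lifted to a
common universe, since `Monoid.CoprodI` only takes such families. -/
def factor (M : Type u) (N : Type v) : Bool → Type (max u v)
  | true => ULift.{v} M
  | false => ULift.{u} N

instance : ∀ b, Group (factor M N b)
  | true => inferInstanceAs (Group (ULift.{v} M))
  | false => inferInstanceAs (Group (ULift.{u} N))

/-- A letter, seen as a letter of the words used for `Monoid.CoprodI`. -/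
def toSigma {M : Type u} {N : Type v} : M ⊕ N → Σ b, factor M N b
  | .inl m => ⟨true, ULift.up m⟩
  | .inr n => ⟨false, ULift.up n⟩

theorem toSigma_injective {M : Type u} {N : Type v} : Function.Injective (toSigma (M := M) (N := N)) := by
  rintro (a | a) (b | b) h <;> cases h <;> rfl

/-- The comparison of the binary free product with the indexed one. -/
def toCoprodI : Monoid.Coprod M N →* Monoid.CoprodI (factor M N) :=
  lift ((Monoid.CoprodI.of (M := factor M N) (i := true)).comp MulEquiv.ulift.symm.toMonoidHom)
    ((Monoid.CoprodI.of (M := factor M N) (i := false)).comp MulEquiv.ulift.symm.toMonoidHom)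

/-- A reduced word, as a word in the sense of `Monoid.CoprodI`. -/
def IsReduced.toWord {l : List (M ⊕ N)} (h : IsReduced l) : Monoid.CoprodI.Word (factor M N) where
  toList := l.map toSigma
  ne_one := by
    simp only [List.mem_map, forall_exists_index, and_imp, forall_apply_eq_imp_iff₂]
    rintro (m | n) ha h1
    · exact (h.1 _ ha).1 (congrArg Sum.inl (congrArg ULift.down h1))
    · exact (h.1 _ ha).2 (congrArg Sum.inr (congrArg ULift.down h1))
  chain_ne := by
    rw [List.isChain_map]
    refine h.2.imp ?_
    rintro (_ | _) (_ | _) <;> simp [toSigma]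

theorem IsReduced.prod_toWord {l : List (M ⊕ N)} (h : IsReduced l) :
    h.toWord.prod = toCoprodI (eval l) := by
  simp only [Monoid.CoprodI.Word.prod, toWord, eval, map_list_prod, List.map_map]
  congr 2
  ext (m | n) <;> rfl

/-- A reduced word is determined by the element that it represents. -/
theorem IsReduced.eq_of_eval_eq {l l' : List (M ⊕ N)} (h : IsReduced l) (h' : IsReduced l')
    (e : eval l = eval l') : l = l' := by
  classical
  have : h.toWord = h'.toWord :=
    Monoid.CoprodI.Word.equiv.symm.injective (by
      change h.toWord.prod = h'.toWord.prod
      rw [h.prod_toWord, h'.prod_toWord, e])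
  exact toSigma_injective.list_map (congrArg Monoid.CoprodI.Word.toList this)

theorem eval_alternating (b a : M ⊕ N) (k : ℕ) :
    eval (alternating b a k) = (letter b * letter a) ^ k := by
  induction k with
  | zero => rfl
  | succ k ih => simp [alternating, ih, pow_succ', mul_assoc]

theorem isReduced_alternating {b a : M ⊕ N} (hb : IsNontrivialLetter b)
    (ha : IsNontrivialLetter a) (hab : b.isLeft ≠ a.isLeft) (k : ℕ) :
    IsReduced (alternating b a k) := by
  induction k with
  | zero => exact isReduced_nil
  | succ k ih =>
    refine isReduced_cons.2 ⟨hb, by simpa using hab, isReduced_cons.2 ⟨ha, ?_, ih⟩⟩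
    cases k <;> simp [alternating, hab.symm]

end Words

end Monoid.Coprod

/-! ### Injective cocycles and the couplings that they define -/

/-- A measurable cocycle `cocycle : Λ × X → Γ` over a measure preserving action of `Λ` on a nonzero
finite standard measure space `X`, such that only the identity of `Λ` is sent to the identity of
`Γ`. By the cocycle identity, `cocycle · x` is then injective for every `x`. Measurability is stated
fiberwise, so that `Γ` needs no measurable structure. -/
structure InjectiveCocycle (Λ : Type u) (Γ : Type v) [Group Λ] [Group Γ] where
  /-- the base space -/
  carrier : Type w
  [measurableSpace : MeasurableSpace carrier]
  [standardBorelSpace : StandardBorelSpace carrier]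
  [action : MulAction Λ carrier]
  /-- the measure of the base space -/
  ν : Measure carrier
  [isFiniteMeasure : IsFiniteMeasure ν]
  ne_zero : ν ≠ 0
  measurePreserving : ∀ l : Λ, MeasurePreserving (fun x : carrier => l • x) ν ν
  /-- the cocycle -/
  cocycle : Λ → carrier → Γ
  measurableSet_cocycle_eq : ∀ l g, MeasurableSet {x | cocycle l x = g}
  cocycle_mul : ∀ l l' x, cocycle (l * l') x = cocycle l (l' • x) * cocycle l' x
  eq_one_of_cocycle_eq_one : ∀ l x, cocycle l x = 1 → l = 1

namespace InjectiveCocycle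

attribute [instance] measurableSpace standardBorelSpace action isFiniteMeasure

variable {Λ : Type u} {Γ : Type v} [Group Λ] [Group Γ] (Z : InjectiveCocycle.{u, v, w} Λ Γ)

@[simp] theorem cocycle_one (x : Z.carrier) : Z.cocycle 1 x = 1 := by
  simpa using Z.cocycle_mul 1 1 x

theorem cocycle_inv (l : Λ) (x : Z.carrier) : Z.cocycle l⁻¹ (l • x) = (Z.cocycle l x)⁻¹ := by
  rw [eq_inv_iff_mul_eq_one, ← Z.cocycle_mul, inv_mul_cancel, cocycle_one]

theorem cocycle_injective (x : Z.carrier) : Function.Injective fun l => Z.cocycle l x := by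
  intro l l' h
  have h1 : Z.cocycle (l * l'⁻¹) (l' • x) = 1 := by
    rw [Z.cocycle_mul, inv_smul_smul, Z.cocycle_inv]
    exact mul_inv_eq_one.2 h
  exact mul_inv_eq_one.1 (Z.eq_one_of_cocycle_eq_one _ _ h1)

/-- If every value of the cocycle is attained over `x`, the same holds over the orbit of `x`. -/
theorem cocycle_surjective_smul {x : Z.carrier} (h : Function.Surjective fun l => Z.cocycle l x)
    (l : Λ) : Function.Surjective fun l' => Z.cocycle l' (l • x) := by
  intro g
  obtain ⟨l', hl'⟩ := h (g * Z.cocycle l x)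
  refine ⟨l' * l⁻¹, ?_⟩
  simp only at hl' ⊢
  rw [Z.cocycle_mul, inv_smul_smul, hl', Z.cocycle_inv, mul_inv_cancel_right]

/-- If the cocycle is not almost surely surjective, some value is missed with positive measure. -/
theorem exists_missed_value [Countable Γ]
    (h : ¬ ∀ᵐ x ∂Z.ν, Function.Surjective fun l => Z.cocycle l x) :
    ∃ g ≠ 1, Z.ν {x | ∀ l, Z.cocycle l x ≠ g} ≠ 0 := by
  by_contra! hg
  refine h ?_
  have : ∀ g : Γ, ∀ᵐ x ∂Z.ν, ∃ l, Z.cocycle l x = g := by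
    intro g
    by_cases h1 : g = 1
    · exact .of_forall fun x => ⟨1, by simp [h1]⟩
    · simpa [ae_iff] using hg g h1
  exact ae_all_iff.2 this

theorem measurableSet_missed [Countable Λ] (g : Γ) :
    MeasurableSet {x | ∀ l, Z.cocycle l x ≠ g} := by
  have : {x | ∀ l, Z.cocycle l x ≠ g} = ⋂ l, {x | Z.cocycle l x = g}ᶜ := by
    ext x
    simp
  rw [this]
  exact .iInter fun l => (Z.measurableSet_cocycle_eq l g).compl

/-- The space `X × Γ` on which the coupling of a cocycle lives. The discrete factor `Γ` is replaced
by a type `E` in bijection with it, which allows a change of universe. -/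
def Skew {E : Type w} (_e : Γ ≃ E) : Type w :=
  Z.carrier × E

section Skew

variable {E : Type w} (e : Γ ≃ E)

instance : MulAction Λ (Z.Skew e) where
  smul l p := (l • p.1, e (Z.cocycle l p.1 * e.symm p.2))
  one_smul p := Prod.ext (one_smul Λ p.1)
    (show e (Z.cocycle 1 p.1 * e.symm p.2) = p.2 by simp)
  mul_smul l l' p := Prod.ext (mul_smul l l' p.1)
    (show e (Z.cocycle (l * l') p.1 * e.symm p.2) =
      e (Z.cocycle l (l' • p.1) * e.symm (e (Z.cocycle l' p.1 * e.symm p.2))) by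
        simp [Z.cocycle_mul, mul_assoc])

instance : MulAction Γ (Z.Skew e) where
  smul g p := (p.1, e (e.symm p.2 * g⁻¹))
  one_smul p := Prod.ext rfl (show e (e.symm p.2 * 1⁻¹) = p.2 by simp)
  mul_smul g g' p := Prod.ext rfl
    (show e (e.symm p.2 * (g * g')⁻¹) = e (e.symm (e (e.symm p.2 * g'⁻¹)) * g⁻¹) by
      simp [mul_assoc])

theorem left_smul_mk (l : Λ) (x : Z.carrier) (t : E) :
    (l • (show Z.Skew e from (x, t)) : Z.Skew e) = (l • x, e (Z.cocycle l x * e.symm t)) := rfl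

theorem right_smul_mk (g : Γ) (x : Z.carrier) (t : E) :
    (g • (show Z.Skew e from (x, t)) : Z.Skew e) = (x, e (e.symm t * g⁻¹)) := rfl

/-- The fundamental domain `X × {1}` for the action of `Γ`. -/
def base : Set (Z.Skew e) :=
  {p | p.2 = e 1}

/-- The points `(x, γ)` at which the value `f γ` is least in the orbit under `Λ`. -/
def minimalPoints (f : Γ → ℕ) : Set (Z.Skew e) :=
  {p | ∀ l : Λ, f (e.symm p.2) ≤ f (Z.cocycle l p.1 * e.symm p.2)}

theorem base_subset_minimalPoints {f : Γ → ℕ} (hf : f 1 = 0) :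
    Z.base e ⊆ Z.minimalPoints e f := by
  rintro ⟨x, t⟩ (rfl : t = e 1) l
  change f (e.symm (e 1)) ≤ _
  simp [hf]

variable [MeasurableSpace E] [DiscreteMeasurableSpace E]

instance : MeasurableSpace (Z.Skew e) :=
  inferInstanceAs (MeasurableSpace (Z.carrier × E))

/-- The product of the measure of the base space with the counting measure. -/
noncomputable def skewMeasure : Measure (Z.Skew e) :=
  Z.ν.prod Measure.count

/-- A permutation of a discrete space preserves the counting measure. -/
theorem map_count_equiv (σ : E ≃ E) : (Measure.count : Measure E).map σ = Measure.count := by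
  refine Measure.ext fun A hA => ?_
  rw [Measure.map_apply (.of_discrete) hA, Measure.count_apply (.of_discrete),
    Measure.count_apply hA, Set.encard_preimage_of_bijective σ.bijective]

variable [Countable E]

instance : StandardBorelSpace (Z.Skew e) :=
  inferInstanceAs (StandardBorelSpace (Z.carrier × E))

instance : SigmaFinite (Z.skewMeasure e) :=
  inferInstanceAs (SigmaFinite (Z.ν.prod Measure.count))

theorem measurePreserving_left_smul (l : Λ) :
    MeasurePreserving (fun p : Z.Skew e => l • p) (Z.skewMeasure e) (Z.skewMeasure e) := by
  refine (Z.measurePreserving l).skew_product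
    (g := fun x t => e (Z.cocycle l x * e.symm t)) ?_ (.of_forall fun x => ?_)
  · refine measurable_from_prod_countable_left fun t => ?_
    refine measurable_to_countable' fun s => ?_
    convert! Z.measurableSet_cocycle_eq l (e.symm s * (e.symm t)⁻¹) using 1
    ext x
    simp [← Equiv.eq_symm_apply, eq_mul_inv_iff_mul_eq]
  · exact map_count_equiv
      ((e.symm.trans (Equiv.mulLeft (Z.cocycle l x))).trans e)

theorem measurePreserving_right_smul (g : Γ) :
    MeasurePreserving (fun p : Z.Skew e => g • p) (Z.skewMeasure e) (Z.skewMeasure e) := by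
  refine (MeasurePreserving.id Z.ν).skew_product
    (g := fun x t => e (e.symm t * g⁻¹)) ?_ (.of_forall fun x => ?_)
  · exact measurable_from_prod_countable_left fun t => measurable_const (a := e (e.symm t * g⁻¹))
  · exact map_count_equiv ((e.symm.trans (Equiv.mulRight g⁻¹)).trans e)

theorem measurableSet_skew_of_fiber {A : Set (Z.Skew e)}
    (h : ∀ t, MeasurableSet {x : Z.carrier | (show Z.Skew e from (x, t)) ∈ A}) :
    MeasurableSet A := by
  have : A = ⋃ t, {x : Z.carrier | (show Z.Skew e from (x, t)) ∈ A} ×ˢ {t} := by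
    ext ⟨x, t⟩
    refine ⟨fun hx => Set.mem_iUnion.2 ⟨t, hx, rfl⟩, fun hx => ?_⟩
    obtain ⟨t', hx', rfl⟩ := Set.mem_iUnion.1 hx
    exact hx'
  rw [this]
  exact MeasurableSet.iUnion fun t => (h t).prod (measurableSet_singleton t)

theorem skewMeasure_fiber (B : Set Z.carrier) (t : E) :
    Z.skewMeasure e {p | p.1 ∈ B ∧ p.2 = t} = Z.ν B := by
  refine (Measure.prod_prod (μ := Z.ν) (ν := Measure.count) B {t}).trans ?_
  rw [Measure.count_singleton, mul_one]

theorem measurableSet_base : MeasurableSet (Z.base e) :=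
  Z.measurableSet_skew_of_fiber e fun t => .const (t = e 1)

theorem isFundamentalDomain_base : IsFundamentalDomain Γ (Z.base e) (Z.skewMeasure e) := by
  refine .mk' (Z.measurableSet_base e).nullMeasurableSet fun ⟨x, t⟩ => ⟨e.symm t, ?_, fun g hg => ?_⟩
  · change e (e.symm t * (e.symm t)⁻¹) = e 1
    rw [mul_inv_cancel]
  · exact (mul_inv_eq_one.1 (e.injective hg)).symm

theorem measurableSet_minimalPoints [Countable Λ] (f : Γ → ℕ) :
    MeasurableSet (Z.minimalPoints e f) := by
  refine Z.measurableSet_skew_of_fiber e fun t => ?_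
  have : {x : Z.carrier | (show Z.Skew e from (x, t)) ∈ Z.minimalPoints e f} =
      ⋂ l : Λ, ⋃ g : {g : Γ // f (e.symm t) ≤ f (g * e.symm t)}, {x | Z.cocycle l x = g} := by
    ext x
    simp only [Set.mem_iInter, Set.mem_iUnion, Set.mem_ofPred_eq, Subtype.exists, exists_prop,
      exists_eq_right']
    rfl
  have : Countable Γ := e.injective.countable
  simp only [*]
  exact .iInter fun l => .iUnion fun g => Z.measurableSet_cocycle_eq l g

theorem isFundamentalDomain_minimalPoints [Countable Λ] {f : Γ → ℕ} (hf : Function.Injective f) :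
    IsFundamentalDomain Λ (Z.minimalPoints e f) (Z.skewMeasure e) := by
  refine .mk' (Z.measurableSet_minimalPoints e f).nullMeasurableSet fun ⟨x, t⟩ => ?_
  have key : ∀ l : Λ, (l • (show Z.Skew e from (x, t)) : Z.Skew e) ∈ Z.minimalPoints e f ↔
      ∀ l', f (Z.cocycle l x * e.symm t) ≤ f (Z.cocycle l' x * e.symm t) := by
    intro l
    rw [left_smul_mk]
    change (∀ l', f (e.symm (e (Z.cocycle l x * e.symm t))) ≤
      f (Z.cocycle l' (l • x) * e.symm (e (Z.cocycle l x * e.symm t)))) ↔ _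
    simp only [Equiv.symm_apply_apply, ← mul_assoc, ← cocycle_mul]
    exact (Equiv.mulRight l).forall_congr_left
      (p := fun l' => f (Z.cocycle l x * e.symm t) ≤ f (Z.cocycle (l' * l) x * e.symm t))
      |>.trans (by simp)
  simp only [key]
  refine ⟨Function.argmin fun l => f (Z.cocycle l x * e.symm t),
    fun l' => Function.argmin_le (fun l => f (Z.cocycle l x * e.symm t)) l', fun l hl => ?_⟩
  refine Z.cocycle_injective x (mul_right_cancel (hf (le_antisymm (hl _) ?_)))
  exact Function.argmin_le (fun l => f (Z.cocycle l x * e.symm t)) l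

theorem skewMeasure_base : Z.skewMeasure e (Z.base e) = Z.ν Set.univ := by
  rw [← Z.skewMeasure_fiber e Set.univ (e 1)]
  simp [base]

theorem exists_injective_nat_apply_one_eq_zero [Countable Γ] :
    ∃ f : Γ → ℕ, Function.Injective f ∧ f 1 = 0 := by
  obtain ⟨g, hg⟩ := exists_injective_nat Γ
  refine ⟨fun x => Equiv.swap (g 1) 0 (g x), (Equiv.injective _).comp hg, by simp⟩

/-- The coupling on `X × Γ` defined by a cocycle: `Λ` acts by `l • (x, γ) = (l • x, c l x * γ)`, and
`Γ` by right multiplication. -/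
noncomputable def toCoupling [Countable Λ] : SMICoupling.{u, v, w} Λ Γ where
  carrier := Z.Skew e
  μ := Z.skewMeasure e
  ne_zero h := by
    have := Z.skewMeasure_base e
    rw [h, Measure.coe_zero, Pi.zero_apply, eq_comm, Measure.measure_univ_eq_zero] at this
    exact Z.ne_zero this
  smul_comm := by
    rintro l g ⟨x, t⟩
    simp only [left_smul_mk, right_smul_mk, Equiv.symm_apply_apply, mul_assoc]
    rfl
  measurePreserving_left := Z.measurePreserving_left_smul e
  measurePreserving_right := Z.measurePreserving_right_smul e
  exists_domains := by
    have : Countable Γ := e.injective.countable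
    obtain ⟨f, hf, hf1⟩ := exists_injective_nat_apply_one_eq_zero (Γ := Γ)
    exact ⟨_, _, Z.measurableSet_minimalPoints e f, Z.measurableSet_base e,
      Z.isFundamentalDomain_minimalPoints e hf, Z.isFundamentalDomain_base e,
      by rw [skewMeasure_base]; exact measure_lt_top _ _, Z.base_subset_minimalPoints e hf1⟩

theorem index_toCoupling_eq_one [Countable Λ]
    (h : ∀ᵐ x ∂Z.ν, Function.Surjective fun l => Z.cocycle l x) : (Z.toCoupling e).index = 1 := by
  have : Countable Γ := e.injective.countable
  obtain ⟨f, hf, hf1⟩ := exists_injective_nat_apply_one_eq_zero (Γ := Γ)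
  have hY := Z.isFundamentalDomain_minimalPoints e hf
  rw [(Z.toCoupling e).index_eq hY (Z.isFundamentalDomain_base e)]
  -- Over a point where the cocycle is surjective, each orbit meets `X × {1}`.
  have hsub : Z.minimalPoints e f \ Z.base e ⊆
      {x | ¬ Function.Surjective fun l => Z.cocycle l x} ×ˢ Set.univ := by
    rintro ⟨x, t⟩ ⟨hx, hx'⟩
    refine ⟨fun hs => hx' ?_, trivial⟩
    obtain ⟨l, hl⟩ := hs (e.symm t)⁻¹
    have h0 : f (e.symm t) ≤ f (Z.cocycle l x * e.symm t) := hx l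
    simp only at hl
    rw [hl, inv_mul_cancel, hf1, Nat.le_zero, ← hf1] at h0
    exact (Equiv.symm_apply_eq e).1 (hf h0)
  have hnull : Z.skewMeasure e (Z.minimalPoints e f \ Z.base e) = 0 := by
    refine measure_mono_null hsub ((Measure.prod_prod _ _).trans ?_)
    rw [show Z.ν {x | ¬ Function.Surjective fun l => Z.cocycle l x} = 0 from h, zero_mul]
  have hle : Z.skewMeasure e (Z.minimalPoints e f) = Z.skewMeasure e (Z.base e) :=
    (measure_mono_ae (ae_le_set.2 hnull)).antisymm
      (measure_mono (Z.base_subset_minimalPoints e hf1))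
  change Z.skewMeasure e _ / Z.skewMeasure e _ = 1
  rw [hle, skewMeasure_base]
  exact ENNReal.div_self (mt Measure.measure_univ_eq_zero.1 Z.ne_zero) (measure_ne_top _ _)

/-- If over a set `B` of positive measure the cocycle never takes the values `u, u², u³, …`, then the
index is infinite: the sets `B × {u ^ n}` together meet every orbit of `Λ` at most once. -/
theorem index_toCoupling_eq_top [Countable Λ] {B : Set Z.carrier} (hB : MeasurableSet B)
    (hB0 : Z.ν B ≠ 0) {u : Γ} (hu : ∀ x ∈ B, ∀ l, ∀ k : ℕ, Z.cocycle l x ≠ u ^ (k + 1)) :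
    (Z.toCoupling e).index = ∞ := by
  have : Countable Γ := e.injective.countable
  have hfin : Z.skewMeasure e (Z.base e) ≠ ∞ := by
    rw [skewMeasure_base]; exact measure_ne_top _ _
  obtain ⟨f, hf, hf1⟩ := exists_injective_nat_apply_one_eq_zero (Γ := Γ)
  have hY := Z.isFundamentalDomain_minimalPoints e hf
  rw [(Z.toCoupling e).index_eq hY (Z.isFundamentalDomain_base e)]
  change Z.skewMeasure e _ / Z.skewMeasure e _ = ∞
  rw [ENNReal.div_eq_top]
  refine .inr ⟨?_, hfin⟩
  obtain ⟨x₀, hx₀⟩ := nonempty_of_measure_ne_zero hB0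
  -- The value `1` of the cocycle at the identity of `Λ` shows that no positive power of `u` is trivial.
  have hu_inj : ∀ {m n : ℕ}, u ^ m = u ^ n → m ≤ n → m = n := by
    intro m n h hmn
    obtain ⟨k, rfl⟩ := Nat.exists_eq_add_of_le hmn
    rw [pow_add, left_eq_mul] at h
    rcases k with _ | k
    · rfl
    · exact (hu x₀ hx₀ 1 k (by rw [cocycle_one, h])).elim
  let T : ℕ → Set (Z.Skew e) := fun n => {p | p.1 ∈ B ∧ p.2 = e (u ^ n)}
  have hTm : ∀ n, MeasurableSet (T n) := fun n => hB.prod (measurableSet_singleton (e (u ^ n)))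
  have hTd : Pairwise (Function.onFun Disjoint T) := by
    intro m n hmn
    refine Set.disjoint_left.2 fun p hp hp' => hmn ?_
    have h := e.injective (hp.2.symm.trans hp'.2)
    exact (le_total m n).elim (hu_inj h) fun h' => (hu_inj h.symm h').symm
  have hTtop : Z.skewMeasure e (⋃ n, T n) = ∞ := by
    rw [measure_iUnion hTd hTm]
    simp only [T, skewMeasure_fiber]
    exact ENNReal.tsum_const_eq_top_of_ne_zero hB0
  -- The hypothesis excludes that an element of `Λ` moves a point of `T m` to a point of `T n` if `m < n`.
  -- The opposite case is reduced to this one by passing to the inverse.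
  have hlt : ∀ {x : Z.carrier} {l : Λ} {m n : ℕ}, x ∈ B → m < n →
      Z.cocycle l x * u ^ m = u ^ n → False := by
    intro x l m n hx hmn h
    obtain ⟨k, rfl⟩ := Nat.exists_eq_add_of_lt hmn
    refine hu x hx l k (mul_right_cancel (b := u ^ m) ?_)
    rw [h, ← pow_add]
    congr 1
    omega
  have : MeasurableConstSMul Λ (Z.Skew e) :=
    ⟨fun l => (Z.measurePreserving_left_smul e l).measurable⟩
  have : SMulInvariantMeasure Λ (Z.Skew e) (Z.skewMeasure e) :=
    ⟨fun l _ hs => (Z.measurePreserving_left_smul e l).measure_preimage hs.nullMeasurableSet⟩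
  refine top_unique (hTtop.symm.le.trans (not_lt.1 fun hlt' => ?_))
  obtain ⟨p, hp, q, hq, l, hl, h⟩ : ∃ x ∈ ⋃ n, T n, ∃ y ∈ ⋃ n, T n, ∃ g, g ≠ (1 : Λ) ∧ g • x = y :=
    hY.exists_ne_one_smul_eq (MeasurableSet.iUnion hTm).nullMeasurableSet hlt'
  obtain ⟨m, hpB, hpm⟩ := Set.mem_iUnion.1 hp
  obtain ⟨n, hqB, hqn⟩ := Set.mem_iUnion.1 hq
  obtain ⟨x, t⟩ := p
  change t = _ at hpm
  change x ∈ B at hpB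
  rw [left_smul_mk] at h
  subst h
  change l • x ∈ B at hqB
  replace hqn : Z.cocycle l x * u ^ m = u ^ n := by
    rw [hpm, Equiv.symm_apply_apply] at hqn
    exact e.injective hqn
  rcases lt_trichotomy m n with hmn | rfl | hmn
  · exact hlt hpB hmn hqn
  · exact hl (Z.eq_one_of_cocycle_eq_one l x (mul_eq_right.1 hqn))
  · refine hlt (l := l⁻¹) hqB hmn ?_
    rw [cocycle_inv, ← hqn, inv_mul_cancel_left]

end Skew

end InjectiveCocycle

/-! ### The injective cocycle of a coupling -/

namespace SMICoupling

open scoped Pointwise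

variable {Λ : Type u} {Γ : Type v} [Group Λ] [Group Γ]

section Domain

variable (S : SMICoupling.{u, v, w} Λ Γ) (X : Set S.carrier)

/-- The points at which the properties of a domain `X` for `Γ` that hold almost everywhere hold
without exception, along the whole orbit under `Λ × Γ`: each orbit of `Γ` meets `X` exactly once,
and two points of `X` in the same orbit of `Λ` are only related by the identity. -/
def goodSet : Set S.carrier :=
  {x | (∀ l : Λ, ∃! g : Γ, g • l • x ∈ X) ∧
    ∀ (l' : Λ) (g : Γ) (l : Λ), l ≠ 1 → ¬ (g • l' • x ∈ X ∧ l • g • l' • x ∈ X)}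

variable {S X}

theorem left_smul_mem_goodSet {x : S.carrier} (hx : x ∈ S.goodSet X) (l : Λ) :
    l • x ∈ S.goodSet X := by
  refine ⟨fun l' => ?_, fun l' g k => ?_⟩
  · rw [← mul_smul]; exact hx.1 _
  · rw [← mul_smul l' l]; exact hx.2 _ _ _

theorem right_smul_mem_goodSet {x : S.carrier} (hx : x ∈ S.goodSet X) (g : Γ) :
    g • x ∈ S.goodSet X := by
  refine ⟨fun l' => ?_, fun l' g' k => ?_⟩
  · obtain ⟨h, hh, hu⟩ := hx.1 l'
    refine ⟨h * g⁻¹, ?_, fun k hk => ?_⟩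
    · change (h * g⁻¹) • l' • g • x ∈ X
      rw [S.smul_comm, ← mul_smul, inv_mul_cancel_right]; exact hh
    · change k • l' • g • x ∈ X at hk
      rw [S.smul_comm, ← mul_smul] at hk
      rw [← hu _ hk, mul_inv_cancel_right]
  · rw [S.smul_comm l' g, ← mul_smul g' g]; exact hx.2 _ _ _

theorem smul_mem_goodSet_iff {x : S.carrier} (g : Γ) (l : Λ) :
    g • l • x ∈ S.goodSet X ↔ x ∈ S.goodSet X := by
  refine ⟨fun h => ?_, fun h => right_smul_mem_goodSet (left_smul_mem_goodSet h l) g⟩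
  have := left_smul_mem_goodSet (right_smul_mem_goodSet h g⁻¹) l⁻¹
  rwa [inv_smul_smul, inv_smul_smul] at this

instance : MeasurableConstSMul Λ S.carrier :=
  ⟨fun l => (S.measurePreserving_left l).measurable⟩

instance : MeasurableConstSMul Γ S.carrier :=
  ⟨fun g => (S.measurePreserving_right g).measurable⟩

instance : SMulInvariantMeasure Λ S.carrier S.μ :=
  ⟨fun l _ hs => (S.measurePreserving_left l).measure_preimage hs.nullMeasurableSet⟩

instance : SMulInvariantMeasure Γ S.carrier S.μ :=
  ⟨fun g _ hs => (S.measurePreserving_right g).measure_preimage hs.nullMeasurableSet⟩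

instance : SMulCommClass Λ Γ S.carrier :=
  ⟨S.smul_comm⟩

/-- A property that holds almost everywhere holds along almost every orbit of `Λ × Γ`. -/
theorem ae_forall_smul [Countable Λ] [Countable Γ] {p : S.carrier → Prop} (h : ∀ᵐ x ∂S.μ, p x) :
    ∀ᵐ x ∂S.μ, ∀ (l : Λ) (g : Γ), p (g • l • x) := by
  rw [ae_all_iff]
  intro l
  rw [ae_all_iff]
  intro g
  exact ((S.measurePreserving_right g).comp
    (S.measurePreserving_left l)).quasiMeasurePreserving.ae h

theorem measurableSet_goodSet [Countable Λ] [Countable Γ] (hX : MeasurableSet X) :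
    MeasurableSet (S.goodSet X) := by
  have h1 : ∀ (g : Γ) (l : Λ), Measurable fun x : S.carrier => g • l • x := fun g l =>
    (measurable_const_smul g).comp (measurable_const_smul l)
  have h2 : ∀ (g : Γ) (l l' : Λ), Measurable fun x : S.carrier => l' • g • l • x := fun g l l' =>
    (measurable_const_smul l').comp (h1 g l)
  refine measurableSet_setOfPred.2 (.and (.forall fun l => ?_)
    (.forall fun l' => .forall fun g => .forall fun l => .imp measurable_const (.not (.and ?_ ?_))))
  · exact .exists fun g => .and (hX.mem.comp (h1 g l))
      (.forall fun g' => .imp (hX.mem.comp (h1 g' l)) measurable_const)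
  · exact hX.mem.comp (h1 g l')
  · exact hX.mem.comp (h2 g l' l)

theorem ae_mem_goodSet [Countable Λ] [Countable Γ] {Y : Set S.carrier}
    (hY : IsFundamentalDomain Λ Y S.μ) (hX : IsFundamentalDomain Γ X S.μ) (hXY : X ⊆ Y) :
    ∀ᵐ x ∂S.μ, x ∈ S.goodSet X := by
  have h1 : ∀ᵐ x ∂S.μ, ∃! g : Γ, g • x ∈ X := by
    have : ∀ᵐ x ∂S.μ, ∀ g g' : Γ, g ≠ g' → ¬ (x ∈ g • X ∧ x ∈ g' • X) := by
      simp only [ae_all_iff]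
      intro g g' hg
      exact measure_eq_zero_iff_ae_notMem.1 (hX.aedisjoint hg)
    filter_upwards [hX.ae_covers, this] with x ⟨g, hg⟩ h
    refine ⟨g, hg, fun g' hg' => ?_⟩
    by_contra hne
    exact h g'⁻¹ g⁻¹ (by simpa using hne)
      ⟨Set.mem_inv_smul_set_iff.2 hg', Set.mem_inv_smul_set_iff.2 hg⟩
  have h2 : ∀ᵐ x ∂S.μ, ∀ l : Λ, l ≠ 1 → ¬ (x ∈ X ∧ l • x ∈ X) := by
    simp only [ae_all_iff]
    intro l hl
    refine measure_mono_null ?_ (hY.aedisjoint (inv_ne_one.2 hl))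
    intro x hx
    have hx : x ∈ X ∧ l • x ∈ X := not_not.1 hx
    exact ⟨Set.mem_inv_smul_set_iff.2 (hXY hx.2), by simpa only [one_smul] using hXY hx.1⟩
  filter_upwards [ae_forall_smul h1, ae_forall_smul h2] with x hx1 hx2
  exact ⟨fun l => by simpa using hx1 l 1, hx2⟩

variable (S X) in
/-- The points of the domain `X` whose orbits contain no exceptional points. -/
abbrev Base : Type w :=
  {x : S.carrier // x ∈ X ∩ S.goodSet X}

variable (S X) in
/-- The element of `Γ` that moves a point of the good set into the domain `X`. -/
noncomputable def returnElement (x : S.carrier) : Γ :=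
  Classical.epsilon fun g => g • x ∈ X

theorem returnElement_smul_mem {x : S.carrier} (hx : x ∈ S.goodSet X) :
    S.returnElement X x • x ∈ X :=
  Classical.epsilon_spec (p := fun g : Γ => g • x ∈ X) (by simpa using (hx.1 1).exists)

theorem returnElement_eq_iff {x : S.carrier} (hx : x ∈ S.goodSet X) {g : Γ} :
    S.returnElement X x = g ↔ g • x ∈ X := by
  refine ⟨fun h => h ▸ returnElement_smul_mem hx, fun h => ?_⟩
  have := hx.1 1
  simp only [one_smul] at this
  exact this.unique (returnElement_smul_mem hx) h

noncomputable instance : MulAction Λ (S.Base X) where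
  smul l x := ⟨S.returnElement X (l • x.1) • l • x.1,
    returnElement_smul_mem (left_smul_mem_goodSet x.2.2 l),
    right_smul_mem_goodSet (left_smul_mem_goodSet x.2.2 l) _⟩
  one_smul x := Subtype.ext <| by
    change S.returnElement X ((1 : Λ) • x.1) • (1 : Λ) • x.1 = x.1
    have : S.returnElement X x.1 = 1 := (returnElement_eq_iff x.2.2).2 (by simpa using x.2.1)
    rw [one_smul, this, one_smul]
  mul_smul l l' x := Subtype.ext <| by
    change S.returnElement X ((l * l') • x.1) • (l * l') • x.1 =
      S.returnElement X (l • S.returnElement X (l' • x.1) • l' • x.1) •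
        l • S.returnElement X (l' • x.1) • l' • x.1
    have h := returnElement_smul_mem (left_smul_mem_goodSet
      (right_smul_mem_goodSet (left_smul_mem_goodSet x.2.2 l') (S.returnElement X (l' • x.1))) l)
    rw [S.smul_comm l, ← mul_smul l l', ← mul_smul] at h ⊢
    rw [(returnElement_eq_iff (left_smul_mem_goodSet x.2.2 _)).2 h]

theorem base_coe_smul (l : Λ) (x : S.Base X) :
    (l • x).1 = S.returnElement X (l • x.1) • l • x.1 := rfl

theorem returnElement_mul (l l' : Λ) (x : S.Base X) :
    S.returnElement X ((l * l') • x.1) =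
      S.returnElement X (l • (l' • x).1) * S.returnElement X (l' • x.1) := by
  rw [returnElement_eq_iff (left_smul_mem_goodSet x.2.2 _), mul_smul, mul_smul, ← S.smul_comm l,
    ← base_coe_smul]
  exact returnElement_smul_mem (left_smul_mem_goodSet (l' • x).2.2 l)

theorem eq_one_of_returnElement_eq_one (l : Λ) (x : S.Base X)
    (h : S.returnElement X (l • x.1) = 1) : l = 1 := by
  by_contra hl
  refine x.2.2.2 1 1 l hl ⟨by simpa using x.2.1, ?_⟩
  rw [returnElement_eq_iff (left_smul_mem_goodSet x.2.2 l)] at h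
  simpa using h

variable (S X) in
/-- The restriction of the measure of the coupling. -/
noncomputable def baseMeasure : Measure (S.Base X) :=
  S.μ.comap Subtype.val

variable [Countable Λ] [Countable Γ]

theorem measurableEmbedding_base (hX : MeasurableSet X) :
    MeasurableEmbedding (Subtype.val : S.Base X → S.carrier) :=
  .subtype_coe (hX.inter (measurableSet_goodSet hX))

theorem baseMeasure_apply (hX : MeasurableSet X) (A : Set (S.Base X)) :
    S.baseMeasure X A = S.μ (Subtype.val '' A) :=
  (measurableEmbedding_base hX).comap_apply _ _

theorem ae_baseMeasure_iff (hX : MeasurableSet X) {p : S.carrier → Prop} :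
    (∀ᵐ x ∂S.baseMeasure X, p x.1) ↔ ∀ᵐ x ∂S.μ, x ∈ X ∩ S.goodSet X → p x := by
  rw [← ae_restrict_iff' (hX.inter (measurableSet_goodSet hX)),
    ← (measurableEmbedding_base hX).ae_map_iff, baseMeasure,
    (measurableEmbedding_base hX).map_comap]
  exact Iff.of_eq (congrArg (fun s => ∀ᵐ x ∂S.μ.restrict s, p x) Subtype.range_val)

theorem measurableSet_returnElement_eq (hX : MeasurableSet X) (l : Λ) (g : Γ) :
    MeasurableSet {x : S.Base X | S.returnElement X (l • x.1) = g} := by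
  have : {x : S.Base X | S.returnElement X (l • x.1) = g} =
      (fun x : S.Base X => g • l • x.1) ⁻¹' X := by
    ext x
    exact returnElement_eq_iff (left_smul_mem_goodSet x.2.2 l)
  rw [this]
  exact ((measurable_const_smul g).comp ((measurable_const_smul l).comp
    (measurableEmbedding_base hX).measurable)) hX

/-- The saturation of `A` under `Γ` has the same measure in the domains `X` and `l • X`, which makes
the action of `l` on the base measure preserving. -/
theorem measurePreserving_base (hX : MeasurableSet X) (hXd : IsFundamentalDomain Γ X S.μ) (l : Λ) :
    MeasurePreserving (fun x : S.Base X => l • x) (S.baseMeasure X) (S.baseMeasure X) := by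
  -- The preimage of `A` under the action on the base is cut out by the `Γ`-saturation of `A`.
  have key : ∀ A : Set (S.Base X), (fun x : S.Base X => l • x) ⁻¹' A =
      (fun x : S.Base X => l • x.1) ⁻¹' ⋃ g : Γ, (fun x => g • x) ⁻¹' (Subtype.val '' A) := by
    intro A
    ext x
    simp only [Set.mem_preimage, Set.mem_iUnion]
    refine ⟨fun h => ⟨_, l • x, h, rfl⟩, ?_⟩
    rintro ⟨g, y, hy, hyx⟩
    have : S.returnElement X (l • x.1) = g :=
      (returnElement_eq_iff (left_smul_mem_goodSet x.2.2 l)).2 (hyx ▸ y.2.1)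
    have : l • x = y := Subtype.ext (by rw [base_coe_smul, this, ← hyx])
    rwa [this]
  have hsat : ∀ A : Set (S.Base X), MeasurableSet A →
      MeasurableSet (⋃ g : Γ, (fun x => g • x) ⁻¹' (Subtype.val '' A)) := fun A hA =>
    .iUnion fun g => measurable_const_smul g ((measurableEmbedding_base hX).measurableSet_image' hA)
  have hmeas : Measurable fun x : S.Base X => l • x := by
    intro A hA
    rw [key]
    exact ((measurable_const_smul l).comp (measurableEmbedding_base hX).measurable) (hsat A hA)
  refine ⟨hmeas, Measure.ext fun A hA => ?_⟩
  rw [Measure.map_apply hmeas hA, key, baseMeasure_apply hX, baseMeasure_apply hX]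
  set A' := ⋃ g : Γ, (fun x => g • x) ⁻¹' (Subtype.val '' A) with hA'
  have hA'good : A' ⊆ S.goodSet X := by
    intro x hx
    obtain ⟨g, y, -, hyx⟩ := Set.mem_iUnion.1 hx
    have := y.2.2
    rw [hyx] at this
    exact (smul_mem_goodSet_iff g 1).1 (by simpa using this)
  have hinv : ∀ g : Γ, (fun x => g • x) ⁻¹' A' = A' := by
    intro g
    ext x
    simp only [hA', Set.mem_preimage, Set.mem_iUnion, ← mul_smul]
    exact (Equiv.mulRight g).exists_congr_left.trans (by simp)
  have h1 : Subtype.val '' ((fun x : S.Base X => l • x.1) ⁻¹' A') =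
      (fun x => l • x) ⁻¹' (A' ∩ l • X) := by
    ext x
    constructor
    · rintro ⟨y, hy, rfl⟩
      exact ⟨hy, Set.smul_mem_smul_set y.2.1⟩
    · rintro ⟨hx, hx'⟩
      exact ⟨⟨x, Set.smul_mem_smul_set_iff.1 hx',
        (smul_mem_goodSet_iff 1 l).1 (by simpa using hA'good hx)⟩, hx, rfl⟩
  have h2 : Subtype.val '' A = A' ∩ X := by
    ext x
    constructor
    · rintro ⟨y, hy, rfl⟩
      exact ⟨Set.mem_iUnion.2 ⟨1, y, hy, by simp⟩, y.2.1⟩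
    · rintro ⟨hx, hx'⟩
      obtain ⟨g, y, hy, hyx⟩ := Set.mem_iUnion.1 hx
      have hg : g = 1 := by
        have hgX : g • x ∈ X := by
          rw [← show y.1 = g • x from hyx]
          exact y.2.1
        rw [← (returnElement_eq_iff (hA'good hx)).2 hgX]
        exact (returnElement_eq_iff (hA'good hx)).2 (by simpa using hx')
      exact ⟨y, hy, by simpa [hg] using hyx⟩
  rw [h1, h2, measure_preimage_smul_of_nullMeasurableSet
    ((hsat A hA).nullMeasurableSet.inter (hX.const_smul l).nullMeasurableSet)]
  exact (hXd.smul_of_comm l).measure_set_eq hXd (hsat A hA) hinv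

end Domain

/-- A coupling defines an injective cocycle over a domain for `Γ`, and the index is one exactly when
almost every value of the cocycle, as a map `Λ → Γ`, is surjective. -/
theorem exists_injectiveCocycle [Countable Λ] [Countable Γ] (S : SMICoupling.{u, v, w} Λ Γ) :
    ∃ Z : InjectiveCocycle.{u, v, w} Λ Γ,
      S.index = 1 ↔ ∀ᵐ x ∂Z.ν, Function.Surjective fun l => Z.cocycle l x := by
  obtain ⟨Y, X, hYm, hXm, hY, hX, hfin, hXY⟩ := S.exists_domains
  have hgood := ae_mem_goodSet hY hX hXY
  have hX0 : S.μ X ≠ 0 := hX.measure_ne_zero S.ne_zero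
  have huniv : S.baseMeasure X Set.univ = S.μ X := by
    rw [baseMeasure_apply hXm, Set.image_univ]
    refine (congrArg S.μ Subtype.range_val).trans (measure_congr ?_)
    filter_upwards [hgood] with x hx
    exact propext (and_iff_left hx)
  let Z : InjectiveCocycle.{u, v, w} Λ Γ :=
    { carrier := S.Base X
      standardBorelSpace := (hXm.inter (measurableSet_goodSet hXm)).standardBorel
      ν := S.baseMeasure X
      isFiniteMeasure := ⟨huniv ▸ hfin⟩
      ne_zero := fun h => hX0 (by rw [← huniv, h]; rfl)
      measurePreserving := measurePreserving_base hXm hX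
      cocycle := fun l x => S.returnElement X (l • x.1)
      measurableSet_cocycle_eq := measurableSet_returnElement_eq hXm
      cocycle_mul := returnElement_mul
      eq_one_of_cocycle_eq_one := eq_one_of_returnElement_eq_one }
  refine ⟨Z, ?_⟩
  have hsurj : (∀ᵐ x ∂Z.ν, Function.Surjective fun l => Z.cocycle l x) ↔
      ∀ᵐ x ∂S.μ, x ∈ X ∩ S.goodSet X → ∀ g : Γ, ∃ l : Λ, g • l • x ∈ X := by
    rw [← ae_baseMeasure_iff hXm]
    refine Filter.eventually_congr (.of_forall fun x => forall_congr' fun g => exists_congr fun l => ?_)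
    exact returnElement_eq_iff (left_smul_mem_goodSet x.2.2 l)
  rw [hsurj]
  constructor
  · intro h
    rw [S.index_eq hY hX, ENNReal.div_eq_one_iff hX0 hfin.ne] at h
    have hnull : S.μ (Y \ X) = 0 := by
      rw [measure_sdiff hXY hXm.nullMeasurableSet hfin.ne, h, tsub_self]
    -- Index one means that `X` fills `Y` up to a null set, so almost every `Λ`-orbit meets `X`.
    have h1 : ∀ᵐ x ∂S.μ, ∃ l : Λ, l • x ∈ X := by
      filter_upwards [hY.ae_covers, ae_forall_smul (measure_eq_zero_iff_ae_notMem.1 hnull)]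
        with x ⟨l, hl⟩ hx
      refine ⟨l, by_contra fun hlX => hx l 1 ⟨?_, ?_⟩⟩ <;> simpa
    filter_upwards [ae_forall_smul h1] with x hx _ g
    obtain ⟨l, hl⟩ := hx 1 g
    exact ⟨l, by simpa [S.smul_comm] using hl⟩
  · intro h
    -- Surjectivity of the cocycle makes `X` itself a domain for `Λ`.
    have hXΛ : IsFundamentalDomain Λ X S.μ :=
      { nullMeasurableSet := hX.nullMeasurableSet
        ae_covers := by
          filter_upwards [hgood, ae_forall_smul h] with x hx hx'
          have hg : S.returnElement X x • x ∈ X := returnElement_smul_mem hx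
          obtain ⟨l, hl⟩ := hx' 1 (S.returnElement X x)
            (by simpa using ⟨hg, right_smul_mem_goodSet hx _⟩) (S.returnElement X x)⁻¹
          exact ⟨l, by simpa [S.smul_comm] using hl⟩
        aedisjoint := fun l l' hl => (hY.aedisjoint hl).mono
          (Set.smul_set_mono hXY) (Set.smul_set_mono hXY) }
    rw [S.index_eq hXΛ hX, ENNReal.div_self hX0 hfin.ne]

end SMICoupling

/-! ### The free product of two injective cocycles -/

theorem Monoid.Coprod.countable (M : Type u) (N : Type v) [Group M] [Group N] [Countable M]
    [Countable N] : Countable (Monoid.Coprod M N) :=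
  have : Countable (FreeMonoid (M ⊕ N)) := inferInstanceAs (Countable (List (M ⊕ N)))
  Monoid.Coprod.mk_surjective.countable

namespace InjectiveCocycle

open Monoid.Coprod

section FreeProduct

variable {Λ₁ : Type u₁} {Λ₂ : Type u₂} {Γ₁ : Type v₁} {Γ₂ : Type v₂}
  [Group Λ₁] [Group Λ₂] [Group Γ₁] [Group Γ₂]
  (Z₁ : InjectiveCocycle.{u₁, v₁, w} Λ₁ Γ₁) (Z₂ : InjectiveCocycle.{u₂, v₂, w} Λ₂ Γ₂)

/-- The base space of the free product of two cocycles, the product of the base spaces. -/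
def FreeBase : Type w :=
  Z₁.carrier × Z₂.carrier

/-- The free product of the groups acts on the product of the base spaces in such a way that each
factor moves its own coordinate only. -/
noncomputable instance : MulAction (Monoid.Coprod Λ₁ Λ₂) (FreeBase Z₁ Z₂) :=
  MulAction.compHom (FreeBase Z₁ Z₂) (lift
    (MonoidHom.toHomPerm
      { toFun := fun l (x : FreeBase Z₁ Z₂) => (⟨l • x.1, x.2⟩ : FreeBase Z₁ Z₂)
        map_one' := funext fun x => Prod.ext (one_smul Λ₁ x.1) rfl
        map_mul' := fun l l' => funext fun x => Prod.ext (mul_smul l l' x.1) rfl })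
    (MonoidHom.toHomPerm
      { toFun := fun l (x : FreeBase Z₁ Z₂) => (⟨x.1, l • x.2⟩ : FreeBase Z₁ Z₂)
        map_one' := funext fun x => Prod.ext rfl (one_smul Λ₂ x.2)
        map_mul' := fun l l' => funext fun x => Prod.ext rfl (mul_smul l l' x.2) }))

theorem inl_smul (l : Λ₁) (x : FreeBase Z₁ Z₂) :
    (inl l : Monoid.Coprod Λ₁ Λ₂) • x = (l • x.1, x.2) := rfl

theorem inr_smul (l : Λ₂) (x : FreeBase Z₁ Z₂) :
    (inr l : Monoid.Coprod Λ₁ Λ₂) • x = (x.1, l • x.2) := rfl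

/-- The action of the free product on `X₁ × X₂ × (Γ₁ * Γ₂)` whose restrictions to the factors are
given by the two cocycles. The universal property of the free product is all that is needed to
combine the two. -/
noncomputable def freeSkew : Monoid.Coprod Λ₁ Λ₂ →*
    Equiv.Perm (FreeBase Z₁ Z₂ × Monoid.Coprod Γ₁ Γ₂) :=
  lift
    (MonoidHom.toHomPerm
      { toFun := fun l (p : FreeBase Z₁ Z₂ × Monoid.Coprod Γ₁ Γ₂) =>
          ((inl l : Monoid.Coprod Λ₁ Λ₂) • p.1, inl (Z₁.cocycle l p.1.1) * p.2)
        map_one' := funext fun p => Prod.ext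
          (show (inl 1 : Monoid.Coprod Λ₁ Λ₂) • p.1 = p.1 by simp)
          (show inl (Z₁.cocycle 1 p.1.1) * p.2 = p.2 by simp)
        map_mul' := fun l l' => funext fun p => Prod.ext
          (show (inl (l * l') : Monoid.Coprod Λ₁ Λ₂) • p.1 = _ by rw [map_mul, mul_smul]; rfl)
          (show inl (Z₁.cocycle (l * l') p.1.1) * p.2 = _ by
            rw [cocycle_mul, map_mul, mul_assoc]; rfl) })
    (MonoidHom.toHomPerm
      { toFun := fun l (p : FreeBase Z₁ Z₂ × Monoid.Coprod Γ₁ Γ₂) =>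
          ((inr l : Monoid.Coprod Λ₁ Λ₂) • p.1, inr (Z₂.cocycle l p.1.2) * p.2)
        map_one' := funext fun p => Prod.ext
          (show (inr 1 : Monoid.Coprod Λ₁ Λ₂) • p.1 = p.1 by simp)
          (show inr (Z₂.cocycle 1 p.1.2) * p.2 = p.2 by simp)
        map_mul' := fun l l' => funext fun p => Prod.ext
          (show (inr (l * l') : Monoid.Coprod Λ₁ Λ₂) • p.1 = _ by rw [map_mul, mul_smul]; rfl)
          (show inr (Z₂.cocycle (l * l') p.1.2) * p.2 = _ by
            rw [cocycle_mul, map_mul, mul_assoc]; rfl) })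

/-- The cocycle of the free product that extends the two given cocycles. -/
noncomputable def freeCocycle (w : Monoid.Coprod Λ₁ Λ₂) (x : FreeBase Z₁ Z₂) :
    Monoid.Coprod Γ₁ Γ₂ :=
  (freeSkew Z₁ Z₂ w (x, 1)).2

theorem freeSkew_inl (l : Λ₁) (p : FreeBase Z₁ Z₂ × Monoid.Coprod Γ₁ Γ₂) :
    freeSkew Z₁ Z₂ (inl l) p =
      ((inl l : Monoid.Coprod Λ₁ Λ₂) • p.1, inl (Z₁.cocycle l p.1.1) * p.2) := rfl

theorem freeSkew_inr (l : Λ₂) (p : FreeBase Z₁ Z₂ × Monoid.Coprod Γ₁ Γ₂) :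
    freeSkew Z₁ Z₂ (inr l) p =
      ((inr l : Monoid.Coprod Λ₁ Λ₂) • p.1, inr (Z₂.cocycle l p.1.2) * p.2) := rfl

theorem freeSkew_apply (w : Monoid.Coprod Λ₁ Λ₂) (x : FreeBase Z₁ Z₂) (g : Monoid.Coprod Γ₁ Γ₂) :
    freeSkew Z₁ Z₂ w (x, g) = (w • x, freeCocycle Z₁ Z₂ w x * g) := by
  have key : ∀ g, freeSkew Z₁ Z₂ w (x, g) = (w • x, (freeSkew Z₁ Z₂ w (x, 1)).2 * g) := by
    induction w using induction_on' with
    | one => simp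
    | inl_mul l w ih =>
      intro g
      rw [map_mul, Equiv.Perm.mul_apply, Equiv.Perm.mul_apply, ih g, ih 1, freeSkew_inl,
        freeSkew_inl]
      simp [mul_smul, mul_assoc]
    | inr_mul l w ih =>
      intro g
      rw [map_mul, Equiv.Perm.mul_apply, Equiv.Perm.mul_apply, ih g, ih 1, freeSkew_inr,
        freeSkew_inr]
      simp [mul_smul, mul_assoc]
  exact key g

theorem freeCocycle_mul (w w' : Monoid.Coprod Λ₁ Λ₂) (x : FreeBase Z₁ Z₂) :
    freeCocycle Z₁ Z₂ (w * w') x = freeCocycle Z₁ Z₂ w (w' • x) * freeCocycle Z₁ Z₂ w' x := by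
  rw [freeCocycle, map_mul, Equiv.Perm.mul_apply, freeSkew_apply Z₁ Z₂ w', freeSkew_apply, mul_one]

theorem freeCocycle_one (x : FreeBase Z₁ Z₂) : freeCocycle Z₁ Z₂ 1 x = 1 := by
  rw [freeCocycle, map_one]; rfl

theorem freeCocycle_inl (l : Λ₁) (x : FreeBase Z₁ Z₂) :
    freeCocycle Z₁ Z₂ (inl l) x = inl (Z₁.cocycle l x.1) := by
  rw [freeCocycle, freeSkew_inl, mul_one]

theorem freeCocycle_inr (l : Λ₂) (x : FreeBase Z₁ Z₂) :
    freeCocycle Z₁ Z₂ (inr l) x = inr (Z₂.cocycle l x.2) := by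
  rw [freeCocycle, freeSkew_inr, mul_one]

/-- The value of the two cocycles on a letter, again seen as a letter. -/
def letterCocycle : Λ₁ ⊕ Λ₂ → FreeBase Z₁ Z₂ → Γ₁ ⊕ Γ₂
  | .inl l, x => .inl (Z₁.cocycle l x.1)
  | .inr l, x => .inr (Z₂.cocycle l x.2)

theorem letter_letterCocycle (a : Λ₁ ⊕ Λ₂) (x : FreeBase Z₁ Z₂) :
    letter (letterCocycle Z₁ Z₂ a x) = freeCocycle Z₁ Z₂ (letter a) x := by
  rcases a with l | l
  · exact (freeCocycle_inl Z₁ Z₂ l x).symm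
  · exact (freeCocycle_inr Z₁ Z₂ l x).symm

theorem isLeft_letterCocycle (a : Λ₁ ⊕ Λ₂) (x : FreeBase Z₁ Z₂) :
    (letterCocycle Z₁ Z₂ a x).isLeft = a.isLeft := by
  rcases a with l | l <;> rfl

theorem isNontrivialLetter_letterCocycle {a : Λ₁ ⊕ Λ₂} (ha : IsNontrivialLetter a)
    (x : FreeBase Z₁ Z₂) : IsNontrivialLetter (letterCocycle Z₁ Z₂ a x) := by
  rcases a with l | l
  · refine ⟨fun h => ha.1 ?_, by simp [letterCocycle]⟩
    rw [Z₁.eq_one_of_cocycle_eq_one l x.1 (Sum.inl_injective h)]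
  · refine ⟨by simp [letterCocycle], fun h => ha.2 ?_⟩
    rw [Z₂.eq_one_of_cocycle_eq_one l x.2 (Sum.inr_injective h)]

/-- The word whose letters are the values of the two cocycles at the letters of a given word, each
taken at the point to which the letters on its right have moved `x`. -/
noncomputable def trace : List (Λ₁ ⊕ Λ₂) → FreeBase Z₁ Z₂ → List (Γ₁ ⊕ Γ₂)
  | [], _ => []
  | a :: l, x => letterCocycle Z₁ Z₂ a (eval l • x) :: trace l x

theorem eval_trace (l : List (Λ₁ ⊕ Λ₂)) (x : FreeBase Z₁ Z₂) :
    eval (trace Z₁ Z₂ l x) = freeCocycle Z₁ Z₂ (eval l) x := by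
  induction l with
  | nil => exact (freeCocycle_one Z₁ Z₂ x).symm
  | cons a l ih => rw [trace, eval_cons, eval_cons, freeCocycle_mul, ih, letter_letterCocycle]

theorem isReduced_trace {l : List (Λ₁ ⊕ Λ₂)} (hl : IsReduced l) (x : FreeBase Z₁ Z₂) :
    IsReduced (trace Z₁ Z₂ l x) := by
  induction l with
  | nil => exact isReduced_nil
  | cons a l ih =>
    rw [isReduced_cons] at hl
    refine isReduced_cons.2
      ⟨isNontrivialLetter_letterCocycle Z₁ Z₂ hl.1 _, fun b hb => ?_, ih hl.2.2⟩
    rcases l with _ | ⟨a', l⟩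
    · simp [trace] at hb
    · obtain rfl : letterCocycle Z₁ Z₂ a' (eval l • x) = b := by simpa [trace] using hb
      rw [isLeft_letterCocycle, isLeft_letterCocycle]
      exact hl.2.1 a' rfl

theorem exists_letterCocycle_eq_of_getLast?_trace (l : List (Λ₁ ⊕ Λ₂)) (x : FreeBase Z₁ Z₂)
    {a : Γ₁ ⊕ Γ₂} (h : (trace Z₁ Z₂ l x).getLast? = some a) :
    ∃ a', letterCocycle Z₁ Z₂ a' x = a := by
  induction l with
  | nil => simp [trace] at h
  | cons b l ih =>
    rcases l with _ | ⟨c, l⟩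
    · exact ⟨b, by simpa [trace] using h⟩
    · exact ih (by simpa [trace] using h)

theorem eq_one_of_freeCocycle_eq_one (w : Monoid.Coprod Λ₁ Λ₂) (x : FreeBase Z₁ Z₂)
    (h : freeCocycle Z₁ Z₂ w x = 1) : w = 1 := by
  obtain ⟨l, hl, rfl⟩ := exists_isReduced_eval_eq w
  rw [← eval_trace] at h
  have := (isReduced_trace Z₁ Z₂ hl x).eq_of_eval_eq isReduced_nil h
  rcases l with _ | ⟨a, l⟩
  · rfl
  · simp [trace] at this

/-- If `a` is not a value of the letter cocycle at `x`, no value of the free cocycle at `x` is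
represented by a reduced word that ends in `a`. -/
theorem freeCocycle_ne_pow {b a : Γ₁ ⊕ Γ₂} (hb : IsNontrivialLetter b)
    (ha : IsNontrivialLetter a) (hab : b.isLeft ≠ a.isLeft) {x : FreeBase Z₁ Z₂}
    (hx : ∀ a', letterCocycle Z₁ Z₂ a' x ≠ a) (w : Monoid.Coprod Λ₁ Λ₂) (k : ℕ) :
    freeCocycle Z₁ Z₂ w x ≠ (letter b * letter a) ^ (k + 1) := by
  intro h
  obtain ⟨l, hl, rfl⟩ := exists_isReduced_eval_eq w
  rw [← eval_trace, ← eval_alternating] at h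
  have := (isReduced_trace Z₁ Z₂ hl x).eq_of_eval_eq (isReduced_alternating hb ha hab _) h
  obtain ⟨a', ha'⟩ := exists_letterCocycle_eq_of_getLast?_trace Z₁ Z₂ l x
    (this ▸ getLast?_alternating b a k)
  exact hx a' ha'

theorem freeCocycle_surjective {x : FreeBase Z₁ Z₂}
    (h₁ : Function.Surjective fun l => Z₁.cocycle l x.1)
    (h₂ : Function.Surjective fun l => Z₂.cocycle l x.2) :
    Function.Surjective fun w => freeCocycle Z₁ Z₂ w x := by
  -- The two hypotheses persist along the orbit of `x`, so letters can be added one at a time.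
  have horb : ∀ w : Monoid.Coprod Λ₁ Λ₂,
      (Function.Surjective fun l => Z₁.cocycle l (w • x).1) ∧
        Function.Surjective fun l => Z₂.cocycle l (w • x).2 := by
    intro w
    induction w using induction_on' with
    | one => simpa using ⟨h₁, h₂⟩
    | inl_mul l w ih =>
      rw [mul_smul, inl_smul]
      exact ⟨Z₁.cocycle_surjective_smul ih.1 l, ih.2⟩
    | inr_mul l w ih =>
      rw [mul_smul, inr_smul]
      exact ⟨ih.1, Z₂.cocycle_surjective_smul ih.2 l⟩
  intro g
  induction g using induction_on' with
  | one => exact ⟨1, freeCocycle_one Z₁ Z₂ x⟩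
  | inl_mul g₁ g ih =>
    obtain ⟨w, rfl⟩ := ih
    obtain ⟨l, rfl⟩ := (horb w).1 g₁
    exact ⟨inl l * w, by simp only [freeCocycle_mul, freeCocycle_inl]⟩
  | inr_mul g₂ g ih =>
    obtain ⟨w, rfl⟩ := ih
    obtain ⟨l, rfl⟩ := (horb w).2 g₂
    exact ⟨inr l * w, by simp only [freeCocycle_mul, freeCocycle_inr]⟩

instance : MeasurableSpace (FreeBase Z₁ Z₂) :=
  inferInstanceAs (MeasurableSpace (Z₁.carrier × Z₂.carrier))

instance : StandardBorelSpace (FreeBase Z₁ Z₂) :=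
  inferInstanceAs (StandardBorelSpace (Z₁.carrier × Z₂.carrier))

/-- The product of the measures of the base spaces. -/
noncomputable def freeMeasure : Measure (FreeBase Z₁ Z₂) :=
  Z₁.ν.prod Z₂.ν

instance : IsFiniteMeasure (freeMeasure Z₁ Z₂) :=
  inferInstanceAs (IsFiniteMeasure (Z₁.ν.prod Z₂.ν))

theorem measurePreserving_freeBase (w : Monoid.Coprod Λ₁ Λ₂) :
    MeasurePreserving (fun x : FreeBase Z₁ Z₂ => w • x) (freeMeasure Z₁ Z₂)
      (freeMeasure Z₁ Z₂) := by
  induction w using induction_on' with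
  | one => simp only [one_smul]; exact MeasurePreserving.id _
  | inl_mul l w ih =>
    simp only [mul_smul]
    exact MeasurePreserving.comp ((Z₁.measurePreserving l).prod (MeasurePreserving.id Z₂.ν)) ih
  | inr_mul l w ih =>
    simp only [mul_smul]
    exact MeasurePreserving.comp ((MeasurePreserving.id Z₁.ν).prod (Z₂.measurePreserving l)) ih

theorem measurableSet_freeCocycle_eq [Countable Γ₁] [Countable Γ₂] (w : Monoid.Coprod Λ₁ Λ₂)
    (g : Monoid.Coprod Γ₁ Γ₂) : MeasurableSet {x | freeCocycle Z₁ Z₂ w x = g} := by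
  induction w using induction_on' generalizing g with
  | one => simp only [freeCocycle_one]; exact .const _
  | inl_mul l w ih =>
    have : {x | freeCocycle Z₁ Z₂ (inl l * w) x = g} =
        ⋃ h : Γ₁, (fun x => w • x) ⁻¹' (Prod.fst ⁻¹' {y | Z₁.cocycle l y = h}) ∩
          {x | freeCocycle Z₁ Z₂ w x = (inl h)⁻¹ * g} := by
      ext x
      simp [freeCocycle_mul, freeCocycle_inl, eq_inv_mul_iff_mul_eq]
      rfl
    rw [this]
    exact .iUnion fun h => ((measurePreserving_freeBase Z₁ Z₂ w).measurable
      (measurable_fst (Z₁.measurableSet_cocycle_eq l h))).inter (ih _)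
  | inr_mul l w ih =>
    have : {x | freeCocycle Z₁ Z₂ (inr l * w) x = g} =
        ⋃ h : Γ₂, (fun x => w • x) ⁻¹' (Prod.snd ⁻¹' {y | Z₂.cocycle l y = h}) ∩
          {x | freeCocycle Z₁ Z₂ w x = (inr h)⁻¹ * g} := by
      ext x
      simp [freeCocycle_mul, freeCocycle_inr, eq_inv_mul_iff_mul_eq]
      rfl
    rw [this]
    exact .iUnion fun h => ((measurePreserving_freeBase Z₁ Z₂ w).measurable
      (measurable_snd (Z₂.measurableSet_cocycle_eq l h))).inter (ih _)

theorem measure_univ_ne_zero {Λ : Type u} {Γ : Type v} [Group Λ] [Group Γ]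
    (Z : InjectiveCocycle.{u, v, w} Λ Γ) : Z.ν Set.univ ≠ 0 :=
  mt Measure.measure_univ_eq_zero.1 Z.ne_zero

theorem freeMeasure_prod (A : Set Z₁.carrier) (B : Set Z₂.carrier) :
    freeMeasure Z₁ Z₂ {x | x.1 ∈ A ∧ x.2 ∈ B} = Z₁.ν A * Z₂.ν B :=
  Measure.prod_prod A B

/-- The free product of two injective cocycles. -/
noncomputable def freeProduct [Countable Γ₁] [Countable Γ₂] :
    InjectiveCocycle.{max u₁ u₂, max v₁ v₂, w} (Monoid.Coprod Λ₁ Λ₂) (Monoid.Coprod Γ₁ Γ₂) where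
  carrier := FreeBase Z₁ Z₂
  ν := freeMeasure Z₁ Z₂
  ne_zero h := by
    have := freeMeasure_prod Z₁ Z₂ Set.univ Set.univ
    rw [h] at this
    exact mul_ne_zero Z₁.measure_univ_ne_zero Z₂.measure_univ_ne_zero this.symm
  measurePreserving := measurePreserving_freeBase Z₁ Z₂
  cocycle := freeCocycle Z₁ Z₂
  measurableSet_cocycle_eq := measurableSet_freeCocycle_eq Z₁ Z₂
  cocycle_mul := freeCocycle_mul Z₁ Z₂
  eq_one_of_cocycle_eq_one := eq_one_of_freeCocycle_eq_one Z₁ Z₂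

variable [Countable Γ₁] [Countable Γ₂]

theorem ae_surjective_freeProduct (h₁ : ∀ᵐ x ∂Z₁.ν, Function.Surjective fun l => Z₁.cocycle l x)
    (h₂ : ∀ᵐ x ∂Z₂.ν, Function.Surjective fun l => Z₂.cocycle l x) :
    ∀ᵐ x ∂(freeProduct Z₁ Z₂).ν, Function.Surjective fun w => (freeProduct Z₁ Z₂).cocycle w x := by
  have h₁' : ∀ᵐ x ∂freeMeasure Z₁ Z₂, Function.Surjective fun l => Z₁.cocycle l x.1 :=
    Measure.quasiMeasurePreserving_fst.ae h₁
  have h₂' : ∀ᵐ x ∂freeMeasure Z₁ Z₂, Function.Surjective fun l => Z₂.cocycle l x.2 :=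
    Measure.quasiMeasurePreserving_snd.ae h₂
  filter_upwards [h₁', h₂'] with x hx₁ hx₂
  exact freeCocycle_surjective Z₁ Z₂ hx₁ hx₂

/-- If one of the two cocycles misses a value with positive measure, then the free product misses
all positive powers of some element with positive measure. -/
theorem exists_missed_powers [Countable Λ₁] [Countable Λ₂] [Nontrivial Γ₁] [Nontrivial Γ₂]
    (h : ¬ ((∀ᵐ x ∂Z₁.ν, Function.Surjective fun l => Z₁.cocycle l x) ∧
      ∀ᵐ x ∂Z₂.ν, Function.Surjective fun l => Z₂.cocycle l x)) :
    ∃ B : Set (freeProduct Z₁ Z₂).carrier, MeasurableSet B ∧ (freeProduct Z₁ Z₂).ν B ≠ 0 ∧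
      ∃ u, ∀ x ∈ B, ∀ w, ∀ k : ℕ, (freeProduct Z₁ Z₂).cocycle w x ≠ u ^ (k + 1) := by
  rcases not_and_or.1 h with h | h
  · obtain ⟨g, hg, hB⟩ := Z₁.exists_missed_value h
    obtain ⟨g', hg'⟩ := exists_ne (1 : Γ₂)
    refine ⟨Prod.fst ⁻¹' {x | ∀ l, Z₁.cocycle l x ≠ g}, measurable_fst (Z₁.measurableSet_missed g),
      ?_, letter (.inr g') * letter (.inl g), fun x hx => freeCocycle_ne_pow Z₁ Z₂ ?_ ?_ ?_ ?_⟩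
    · have := freeMeasure_prod Z₁ Z₂ {x | ∀ l, Z₁.cocycle l x ≠ g} Set.univ
      simp only [Set.mem_univ, and_true] at this
      exact this.trans_ne (mul_ne_zero hB Z₂.measure_univ_ne_zero)
    · simp [IsNontrivialLetter, hg']
    · simp [IsNontrivialLetter, hg]
    · simp
    · rintro (l | l) hl
      · exact hx l (Sum.inl_injective hl)
      · simp [letterCocycle] at hl
  · obtain ⟨g, hg, hB⟩ := Z₂.exists_missed_value h
    obtain ⟨g', hg'⟩ := exists_ne (1 : Γ₁)
    refine ⟨Prod.snd ⁻¹' {x | ∀ l, Z₂.cocycle l x ≠ g}, measurable_snd (Z₂.measurableSet_missed g),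
      ?_, letter (.inl g') * letter (.inr g), fun x hx => freeCocycle_ne_pow Z₁ Z₂ ?_ ?_ ?_ ?_⟩
    · have := freeMeasure_prod Z₁ Z₂ Set.univ {x | ∀ l, Z₂.cocycle l x ≠ g}
      simp only [Set.mem_univ, true_and] at this
      exact this.trans_ne (mul_ne_zero Z₁.measure_univ_ne_zero hB)
    · simp [IsNontrivialLetter, hg']
    · simp [IsNontrivialLetter, hg]
    · simp
    · rintro (l | l) hl
      · simp [letterCocycle] at hl
      · exact hx l (Sum.inr_injective hl)

end FreeProduct

end InjectiveCocycle

/-! ### Free products of couplings -/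

theorem theoremA {Λ₁ Λ₂ Γ₁ Γ₂ : Type*} [Group Λ₁] [Group Λ₂] [Group Γ₁] [Group Γ₂]
    [Countable Λ₁] [Countable Λ₂] [Countable Γ₁] [Countable Γ₂] :
    (SMI.{_, _, w} Λ₁ Γ₁ → SMI.{_, _, w} Λ₂ Γ₂ →
      SMI.{_, _, w} (Monoid.Coprod Λ₁ Λ₂) (Monoid.Coprod Γ₁ Γ₂)) ∧
    ∀ (S₁ : SMICoupling.{_, _, w} Λ₁ Γ₁) (S₂ : SMICoupling.{_, _, w} Λ₂ Γ₂),
      (S₁.index = 1 ∧ S₂.index = 1 →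
        ∃ S : SMICoupling.{_, _, w} (Monoid.Coprod Λ₁ Λ₂) (Monoid.Coprod Γ₁ Γ₂), S.index = 1) ∧
      (Nontrivial Γ₁ → Nontrivial Γ₂ → ¬ (S₁.index = 1 ∧ S₂.index = 1) →
        ∃ S : SMICoupling.{_, _, w} (Monoid.Coprod Λ₁ Λ₂) (Monoid.Coprod Γ₁ Γ₂), S.index = ∞) := by
  have := Monoid.Coprod.countable Λ₁ Λ₂
  have := Monoid.Coprod.countable Γ₁ Γ₂
  -- `Shrink` moves the discrete factor `Γ₁ * Γ₂` of the new coupling to the universe of the old ones.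
  let e := equivShrink.{w} (Monoid.Coprod Γ₁ Γ₂)
  let : MeasurableSpace (Shrink.{w} (Monoid.Coprod Γ₁ Γ₂)) := ⊤
  have : DiscreteMeasurableSpace (Shrink.{w} (Monoid.Coprod Γ₁ Γ₂)) := ⟨fun _ => trivial⟩
  have : Countable (Shrink.{w} (Monoid.Coprod Γ₁ Γ₂)) := e.symm.injective.countable
  refine ⟨fun ⟨S₁⟩ ⟨S₂⟩ => ?_, fun S₁ S₂ => ?_⟩ <;>
    obtain ⟨Z₁, hZ₁⟩ := S₁.exists_injectiveCocycle <;>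
    obtain ⟨Z₂, hZ₂⟩ := S₂.exists_injectiveCocycle
  · exact ⟨(InjectiveCocycle.freeProduct Z₁ Z₂).toCoupling e⟩
  · rw [hZ₁, hZ₂]
    refine ⟨fun h => ⟨(InjectiveCocycle.freeProduct Z₁ Z₂).toCoupling e, ?_⟩, fun _ _ h =>
      ⟨(InjectiveCocycle.freeProduct Z₁ Z₂).toCoupling e, ?_⟩⟩
    · exact InjectiveCocycle.index_toCoupling_eq_one _ e
        (InjectiveCocycle.ae_surjective_freeProduct Z₁ Z₂ h.1 h.2)
    · obtain ⟨B, hB, hB0, u, hu⟩ := InjectiveCocycle.exists_missed_powers Z₁ Z₂ h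
      exact InjectiveCocycle.index_toCoupling_eq_top _ e hB hB0 hu
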